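/- Let $\mathcal G=(\mathcal V,\mathcal E)$ be a finite directed network (cycles and parallel edges allowed) with source $S$ and sink $D$. Each edge $e$ has unit capacity and a delay $\delta(e)\in\{0,1,2,\dots\}$: what is sent on $e$ in time step $t$ is available at the head of $e$ from step $t+\delta(e)$ on. No directed cycle consists of edges of delay $0$ only. A *secure code* of length $T\ge 1$ over an alphabet of $q\ge 2$ symbols, with respect to a collection $\mathcal A$ of subsets of $\mathcal E$ (the wiretap sets), is given by a random message $M$ with finitely many values and random keys $(K_v)_{v\in\mathcal V}$, all mutually independent, such that: in each of the $T$ steps each edge $e$ carries one symbol, which is a function of the key of the tail of $e$, the signals received there so far and, if the tail is $S$, of $M$; the sink recovers $M$ with probability one from $K_D$ and the signals sent on its incoming edges; and $I(M;X(A))=0$ for all $A\in\mathcal A$, where $X(A)$ denotes all signals sent on the edges of $A$. Its rate is $H(M)/(T\log q)$. The *secrecy capacity* $\mathfrak C$ is the supremum of the rates of all secure codes, over all $T$ and $q$. Let $V\subset\mathcal V$ be a cut with $S\in V$, $D\notin V$, let $e^{\rm fwd}_1,\dots,e^{\rm fwd}_x$ be the edges from $V$ to $V^c$ and $e^{\rm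 bwd}_1,\dots,e^{\rm bwd}_y$ the edges from $V^c$ to $V$. Let $C_{b\to f}$ be the $x\times y$ $(0,1)$-matrix whose entry $(i,j)$ is $1$ if and only if there is a directed path (possibly of length $0$) from the head of $e^{\rm bwd}_j$ to the tail of $e^{\rm fwd}_i$ that passes through nodes of $V$ only, and let $C=\begin{pmatrix}C_{b\to f}\\ I_y\end{pmatrix}$, whose rows correspond to the $x+y$ edges of the cut. Consider uniform wiretap sets, $\mathcal A=\{A\subset\mathcal E:|A|\le z\}$, where $0\le z\le x+y$. Let $\bar C$ be an $(x+y)\times y$ matrix over a finite field $\mathbb F$ that is rank maximized with respect to $C$ and the row sets of $\mathcal A$: $\bar c_{ij}=0$ whenever $c_{ij}=0$, and for each set $R$ of rows that consists of the cut edges of some $A\in\mathcal A$, the submatrix of $\bar C$ formed by the rows in $R$ has the maximum rank among all $|R|\times y$ matrices over $\mathbb F$ that vanish wherever the submatrix of $C$ formed by the rows in $R$ vanishes. Let $k_b$ be the minimum rank of a $z\times y$ submatrix of $\bar C$. Then $$\mathfrak C\le x+k_b-z .$$ -/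

import Mathlib

open MeasureTheory ProbabilityTheory

noncomputable section

/-! ### Discrete entropy -/

/-- Shannon entropy (natural logarithm) of a random variable with finitely many values. -/
def entropy {Ω α : Type*} [MeasurableSpace Ω] [Fintype α] (μ : Measure Ω) (X : Ω → α) : ℝ :=
  ∑ a, Real.negMulLog (μ.real (X ⁻¹' {a}))

/-- Mutual information `I(X; Y) = H(X) + H(Y) - H(X, Y)`. -/
def mutualInfo {Ω α β : Type*} [MeasurableSpace Ω] [Fintype α] [Fintype β]
    (μ : Measure Ω) (X : Ω → α) (Y : Ω → β) : ℝ :=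
  entropy μ X + entropy μ Y - entropy μ (fun ω => (X ω, Y ω))

/-! ### Networks -/

/-- A directed network with node set `V` and edge set `E` (parallel edges and cycles allowed), all
edges of unit capacity. An edge `e` goes from `tail e` to `head e`; what is sent on `e` in time step
`t` is available at `head e` from time step `t + delay e` on. Edges may be free of delay, but no
directed cycle consists of delay-free edges only (causality). -/
structure Network (V E : Type*) where
  tail : E → V
  head : E → V
  delay : E → ℕ
  source : V
  sink : V
  causal : ∀ v, ¬ Relation.TransGen
    (fun u w => ∃ e, tail e = u ∧ head e = w ∧ delay e = 0) v v

namespace Network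

/-- Pairs (edge, time step) whose signal is available at node `v` in time step `t`. -/
abbrev Received {V E : Type*} (N : Network V E) (T : ℕ) (v : V) (t : Fin T) :=
  {p : E × Fin T // N.head p.1 = v ∧ (p.2 : ℕ) + N.delay p.1 ≤ (t : ℕ)}

/-- A secure code of length `T` over an alphabet with `q` symbols for the collection `𝒜` of wiretap
sets. Every edge carries one symbol per time step. All nodes may generate randomness. -/
structure SecureCode {V E : Type*} [Fintype V] [Fintype E] [DecidableEq E] (N : Network V E)
    (𝒜 : Set (Finset E)) where
  /-- number of time steps -/
  T : ℕ
  T_pos : 0 < T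
  /-- alphabet size -/
  q : ℕ
  two_le_q : 2 ≤ q
  /-- number of messages -/
  m : ℕ
  Ω : Type
  [measΩ : MeasurableSpace Ω]
  μ : Measure Ω
  [prob : IsProbabilityMeasure μ]
  /-- the message -/
  M : Ω → Fin m
  measurable_M : Measurable M
  Key : V → Type
  [measKey : ∀ v, MeasurableSpace (Key v)]
  /-- `K v` is the randomness generated at node `v` -/
  K : ∀ v, Ω → Key v
  measurable_K : ∀ v, Measurable (K v)
  indep_K : iIndepFun K μ
  indep_M : IndepFun M (fun ω v => K v ω) μ
  /-- Encoder of edge `e` in time step `t`. Its arguments are the message (`some`, if the tail of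
  `e` is the source, and `none` otherwise), the randomness of the tail, and the signals that
  the tail has received. -/
  enc : ∀ (e : E) (t : Fin T), Option (Fin m) → Key (N.tail e) →
    (N.Received T (N.tail e) t → Fin q) → Fin q
  measurable_enc : ∀ e t o r, Measurable (fun k => enc e t o k r)
  /-- `X e t` is the signal sent on edge `e` in time step `t` -/
  X : E → Fin T → Ω → Fin q
  X_eq : ∀ e t ω, X e t ω =
    enc e t (open Classical in if N.tail e = N.source then some (M ω) else none)
      (K (N.tail e) ω) (fun p => X p.1.1 p.1.2 ω)
  /-- the decoder of the sink -/
  dec : Key N.sink → ({e : E // N.head e = N.sink} → Fin T → Fin q) → Fin m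
  measurable_dec : ∀ r, Measurable (fun k => dec k r)
  decodes : ∀ᵐ ω ∂μ, dec (K N.sink ω) (fun e t => X e.1 t ω) = M ω
  /-- perfect secrecy -/
  secret : ∀ A ∈ 𝒜, mutualInfo μ M (fun ω (e : {e // e ∈ A}) t => X e.1 t ω) = 0

/-- Message entropy per time step, in units of the edge capacity `log q`. -/
def SecureCode.rate {V E : Type*} [Fintype V] [Fintype E] [DecidableEq E] {N : Network V E}
    {𝒜 : Set (Finset E)} (c : N.SecureCode 𝒜) : ℝ :=
  letI := c.measΩ
  entropy c.μ c.M / (c.T * Real.log c.q)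

/-- Supremum of the rates of all secure codes (all lengths, alphabets, key distributions). -/
def secrecyCapacity {V E : Type*} [Fintype V] [Fintype E] [DecidableEq E] (N : Network V E)
    (𝒜 : Set (Finset E)) : EReal :=
  ⨆ c : N.SecureCode 𝒜, (c.rate : EReal)

/-! ### Cuts -/

/-- Forward edges of the cut `W`. -/
abbrev Fwd {V E : Type*} (N : Network V E) (W : Finset V) :=
  {e : E // N.tail e ∈ W ∧ N.head e ∉ W}

/-- Backward edges of the cut `W`. -/
abbrev Bwd {V E : Type*} (N : Network V E) (W : Finset V) :=
  {e : E // N.tail e ∉ W ∧ N.head e ∈ W}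

/-- There is a directed path (possibly of length 0) from `u` to `w` inside `W`, for
`u` and `w` in `W`. -/
def PathInside {V E : Type*} (N : Network V E) (W : Finset V) (u w : V) : Prop :=
  Relation.ReflTransGen
    (fun a b => a ∈ W ∧ b ∈ W ∧ ∃ e, N.tail e = a ∧ N.head e = b) u w

/-- The connectivity matrix `C_{b → f}` from backward to forward edges. -/
def connBF {V E : Type*} (N : Network V E) (W : Finset V) : Matrix (N.Fwd W) (N.Bwd W) ℤ :=
  open Classical in
  Matrix.of fun i j => if N.PathInside W (N.head j.1) (N.tail i.1) then 1 else 0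

/-- The matrix `C`: `C_{b → f}` on top of the identity matrix; rows are the edges of the cut. -/
def connMatrix {V E : Type*} [DecidableEq E] (N : Network V E) (W : Finset V) :
    Matrix (N.Fwd W ⊕ N.Bwd W) (N.Bwd W) ℤ :=
  Matrix.fromRows (N.connBF W) 1

/-- The sets of rows of `C` formed by the cut edges in `A`, for `A` in `𝒜`. -/
def wiretapRows {V E : Type*} (N : Network V E) (W : Finset V) (𝒜 : Set (Finset E)) :
    Set (Finset (N.Fwd W ⊕ N.Bwd W)) :=
  {R | ∃ A ∈ 𝒜, ∀ r, r ∈ R ↔ Sum.elim Subtype.val Subtype.val r ∈ A}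

end Network

/-- All sets of at most `z` edges. -/
def uniformWiretap (E : Type*) (z : ℕ) : Set (Finset E) := {A | A.card ≤ z}

/-! ### Rank maximized matrices -/

/-- The submatrix formed by the rows in `R` (and all columns). -/
def rowSub {m n F : Type*} (C : Matrix m n F) (R : Finset m) : Matrix {i // i ∈ R} n F :=
  C.submatrix Subtype.val id

/-- `Cbar` vanishes where `C` does, and for each `R` in `𝓡` the rows of `Cbar` in `R` form a matrix
of the maximum rank among all matrices over `F` that vanish where those rows of `C` do. -/
def IsRankMaximized {m n F : Type*} [Fintype n] [Field F] (C : Matrix m n ℤ)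
    (𝓡 : Set (Finset m)) (Cbar : Matrix m n F) : Prop :=
  (∀ i j, C i j = 0 → Cbar i j = 0) ∧
  ∀ R ∈ 𝓡, IsGreatest
    {r | ∃ U : Matrix {i // i ∈ R} n F, (∀ i j, rowSub C R i j = 0 → U i j = 0) ∧ U.rank = r}
    (rowSub Cbar R).rank

/-- The minimum rank of a submatrix formed by `z` rows (and all columns); meant for `z` at most
the number of rows. -/
def minRowRank {m n F : Type*} [Fintype n] [Field F] (z : ℕ) (Cbar : Matrix m n F) : ℕ :=
  sInf {r | ∃ R : Finset m, R.card = z ∧ (rowSub Cbar R).rank = r}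

end

/-!
The bound holds because of the way in which the two sides of the cut `W` interact. The side of the
source turns the backward signals into forward signals by means of the message and of its keys; the
side of the sink turns the forward signals into backward signals by means of its own, independent,
keys. Hence the probability that the message is `m`, the forward signals are `f` and the backward
signals are `b` is a product `α m f b * β f b`: `α` is the probability that the side of the source
answers with `f` and has the message `m` when the backward edges are *forced* to carry `b`, and `β`
is the probability that the side of the sink answers with `b` when the forward edges are forced to
carry `f` (`SecureCode.forced`, `SecureCode.X_eq_of_forced`, `SecureCode.measureReal_inter_inter`).
Causality of the network makes the forced signals well defined (`Network.wellFounded_feeds`).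

Let `A` be a wiretap set that consists of edges of the cut, `G` its forward edges and `P` the other
forward edges of the cut. Let `S` be the set of the backward edges outside of `A` from which an edge
in `G` can be reached inside `W`. The signals on `G` depend, on the side of the source, only on the
backward signals on `A` and `S`, whatever the other backward edges carry
(`SecureCode.forced_bwd_congr`). So, writing `a`, `p`, `s`, `q` for the signals on `A`, on `P`, on
`S` and on the remaining backward edges, `α` is bounded by a quantity `γ m a s`, and `γ m a s * β`,
for fixed `p`, is the law of the message and the signals in the network in which the edges in `P`
are forced to carry `p`; it has total mass at most `1` (`SecureCode.forced_eq_forced_fwd`).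
Decodability means that `α m f b` is positive for only one `m` if `β f b` is positive
(`SecureCode.eq_of_forcedEvent`). By secrecy, the entropy of the message is its conditional entropy
given `a`; two applications of Jensen's inequality then bound it by the logarithm of the number of
values of `p` plus that of the number of values of `s` (`sum_condEntropy_le`), so that the rate is
at most `card P + card S` (`SecureCode.rate_le`).

It remains to choose `A`. Take `z` rows of the matrix of the minimum rank `k`. As the matrix is rank
maximized, `k` bounds the rank of all matrices supported on these rows of `C`, in particular the
size of a matching between these rows and the columns. By Hall's theorem
(`exists_card_neighbors_le_of_rank_le`), some of the `z` rows, say `r` of them, have at most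
`k + r - z` neighbours. If these rows form `A`, then a backward edge in `A` is a neighbour of itself,
all edges in `S` are neighbours, and counting gives `card P + card S ≤ x + k - z`.
-/

/-! ### An inequality for the conditional entropy -/

/-- Jensen's inequality for the logarithm, with a bound on the mean. -/
theorem sum_mul_log_le_log {ι : Type*} [Fintype ι] {w y : ι → ℝ} {B : ℝ}
    (hw : ∀ i, 0 ≤ w i) (hw1 : ∑ i, w i = 1) (hB : 0 < B) (hy : ∀ i, 0 < w i → 0 < y i)
    (hwy : ∑ i, w i * y i ≤ B) : ∑ i, w i * Real.log (y i) ≤ Real.log B := by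
  have key : ∀ i, w i * Real.log (y i) ≤ w i * y i / B - w i + w i * Real.log B := by
    intro i
    rcases (hw i).eq_or_lt with h | h
    · simp [← h]
    · have h1 := Real.log_le_sub_one_of_pos (div_pos (hy i h) hB)
      rw [Real.log_div (hy i h).ne' hB.ne'] at h1
      have h2 := mul_le_mul_of_nonneg_left h1 h.le
      rw [mul_div_assoc]
      linarith
  calc ∑ i, w i * Real.log (y i)
      ≤ ∑ i, (w i * y i / B - w i + w i * Real.log B) := Finset.sum_le_sum fun i _ => key i
    _ = (∑ i, w i * y i) / B - 1 + Real.log B := by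
      rw [Finset.sum_add_distrib, Finset.sum_sub_distrib, ← Finset.sum_div, ← Finset.sum_mul, hw1,
        one_mul]
    _ ≤ Real.log B := by
      have : (∑ i, w i * y i) / B ≤ 1 := (div_le_one hB).2 hwy
      linarith

/-- An upper bound for the entropy of `m` given `z`, when the joint law of `(m, z, p, s, q)` is
`α * β`. Here `α m z p s q` stands for the probability that the message is `m` and that the side
of the source sends `z, p`, when it is told that it receives `z, s, q` (the wiretapped signals `z`
lie on both sides); `β` is the corresponding probability for the side of the sink, and `γ m z s`
ignores `p` and `q`. Hypothesis `hdec` says that the receiver can decode, and `hγβ` is the total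
probability when the signals `p` are forced. -/
theorem sum_condEntropy_le {M Z P S Q : Type*} [Fintype M] [Fintype Z] [Fintype P] [Fintype S]
    [Fintype Q] [Nonempty P] [Nonempty S]
    {α : M → Z → P → S → Q → ℝ} {β : Z → P → S → Q → ℝ} {γ : M → Z → S → ℝ}
    (hα : ∀ m z p s q, 0 ≤ α m z p s q) (hβ : ∀ z p s q, 0 ≤ β z p s q)
    (hαγ : ∀ m z p s q, α m z p s q ≤ γ m z s)
    (hdec : ∀ m m' z p s q, m ≠ m' → 0 < α m z p s q * β z p s q → α m' z p s q = 0)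
    (htot : ∑ m, ∑ z, ∑ p, ∑ s, ∑ q, α m z p s q * β z p s q = 1)
    (hγβ : ∀ p, ∑ z, ∑ s, ∑ q, ∑ m, γ m z s * β z p s q ≤ 1)
    {κ : M → Z → ℝ} (hκ : ∀ m z, κ m z = ∑ p, ∑ s, ∑ q, α m z p s q * β z p s q) :
    ∑ m, ∑ z, κ m z * Real.log ((∑ m', κ m' z) / κ m z) ≤
      Real.log (Fintype.card P) + Real.log (Fintype.card S) := by
  have hQ : Nonempty Q := by
    by_contra h
    rw [not_nonempty_iff] at h
    simp at htot
  have hγ : ∀ m z s, 0 ≤ γ m z s := fun m z s =>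
    (hα m z (Classical.arbitrary P) s (Classical.arbitrary Q)).trans (hαγ _ _ _ _ _)
  let w : M × Z × P × S × Q → ℝ :=
    fun i => α i.1 i.2.1 i.2.2.1 i.2.2.2.1 i.2.2.2.2 * β i.2.1 i.2.2.1 i.2.2.2.1 i.2.2.2.2
  let y₁ : M × Z × P × S × Q → ℝ := fun i =>
    (∑ m, γ m i.2.1 i.2.2.2.1) / ∑ m, α m i.2.1 i.2.2.1 i.2.2.2.1 i.2.2.2.2
  let y₂ : M × Z × P × S × Q → ℝ := fun i =>
    γ i.1 i.2.1 i.2.2.2.1 / (∑ m, γ m i.2.1 i.2.2.2.1) * ((∑ m, κ m i.2.1) / κ i.1 i.2.1)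
  -- Where `w > 0`, `log ((∑ m, κ m z) / κ m z) ≤ log y₁ + log y₂`, because `γ` is at least `α` and
  -- the sum of `α` over `m` has only one term. The mean of `y₁` is at most `card P` by `hγβ`, and
  -- that of `y₂` at most `card S`.
  have hw : ∀ i, 0 ≤ w i := fun i => mul_nonneg (hα _ _ _ _ _) (hβ _ _ _ _)
  have hw1 : ∑ i, w i = 1 := by simpa only [w, Fintype.sum_prod_type] using htot
  have hκ0 : ∀ m z, 0 ≤ κ m z := fun m z => by
    rw [hκ]
    exact Finset.sum_nonneg fun p _ => Finset.sum_nonneg fun s _ => Finset.sum_nonneg fun q _ =>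
      mul_nonneg (hα _ _ _ _ _) (hβ _ _ _ _)
  have hκw : ∀ m z p s q, α m z p s q * β z p s q ≤ κ m z := fun m z p s q => by
    have h0 : ∀ p s q, 0 ≤ α m z p s q * β z p s q := fun p s q =>
      mul_nonneg (hα _ _ _ _ _) (hβ _ _ _ _)
    rw [hκ]
    refine le_trans ?_ (Finset.single_le_sum (f := fun p => ∑ s, ∑ q, α m z p s q * β z p s q)
      (fun p _ => Finset.sum_nonneg fun s _ => Finset.sum_nonneg fun q _ => h0 p s q)
      (Finset.mem_univ p))
    refine le_trans ?_ (Finset.single_le_sum (f := fun s => ∑ q, α m z p s q * β z p s q)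
      (fun s _ => Finset.sum_nonneg fun q _ => h0 p s q) (Finset.mem_univ s))
    exact Finset.single_le_sum (f := fun q => α m z p s q * β z p s q) (fun q _ => h0 p s q)
      (Finset.mem_univ q)
  -- what positivity of a weight says about the quantities in `y₁` and `y₂`
  have hpos : ∀ m z p s q, 0 < α m z p s q * β z p s q →
      0 < α m z p s q ∧ ∑ m', α m' z p s q = α m z p s q ∧ 0 < γ m z s ∧ 0 < ∑ m', γ m' z s ∧
        0 < κ m z ∧ 0 < ∑ m', κ m' z := by
    intro m z p s q h
    have h1 : 0 < α m z p s q := pos_of_mul_pos_left h (hβ _ _ _ _)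
    have h2 : 0 < γ m z s := h1.trans_le (hαγ _ _ _ _ _)
    have h3 : 0 < κ m z := h.trans_le (hκw _ _ _ _ _)
    refine ⟨h1, Finset.sum_eq_single m (fun m' _ hm' => hdec m m' z p s q hm'.symm h) (by simp),
      h2, h2.trans_le ?_, h3, h3.trans_le ?_⟩
    · exact Finset.single_le_sum (f := fun m => γ m z s) (fun m _ => hγ m z s) (Finset.mem_univ m)
    · exact Finset.single_le_sum (f := fun m => κ m z) (fun m _ => hκ0 m z) (Finset.mem_univ m)
  have hsum₁ : ∑ i, w i * y₁ i ≤ Fintype.card P := by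
    calc ∑ i, w i * y₁ i
        = ∑ p, ∑ z, ∑ s, ∑ q, ∑ m, α m z p s q * β z p s q *
            ((∑ m, γ m z s) / ∑ m, α m z p s q) := by
          simp only [w, y₁, Fintype.sum_prod_type]
          rw [Finset.sum_comm]
          simp_rw [Finset.sum_comm (s := (Finset.univ : Finset M)) (t := (Finset.univ : Finset P)),
            Finset.sum_comm (s := (Finset.univ : Finset M)) (t := (Finset.univ : Finset S)),
            Finset.sum_comm (s := (Finset.univ : Finset M)) (t := (Finset.univ : Finset Q))]
          rw [Finset.sum_comm]
      _ ≤ ∑ p, ∑ z, ∑ s, ∑ q, ∑ m, γ m z s * β z p s q := by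
          refine Finset.sum_le_sum fun p _ => Finset.sum_le_sum fun z _ =>
            Finset.sum_le_sum fun s _ => Finset.sum_le_sum fun q _ => ?_
          rw [← Finset.sum_mul, ← Finset.sum_mul, ← Finset.sum_mul]
          set a := ∑ m, α m z p s q
          set g := ∑ m, γ m z s
          have hg : 0 ≤ g := Finset.sum_nonneg fun m _ => hγ m z s
          calc a * β z p s q * (g / a) = (a / a) * (g * β z p s q) := by ring
            _ ≤ 1 * (g * β z p s q) := by
              gcongr
              · exact mul_nonneg hg (hβ _ _ _ _)
              · exact div_self_le_one a
            _ = _ := one_mul _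
      _ ≤ ∑ p : P, 1 := Finset.sum_le_sum fun p _ => hγβ p
      _ = Fintype.card P := by simp
  have hsum₂ : ∑ i, w i * y₂ i ≤ Fintype.card S := by
    have hz1 : ∑ z, ∑ m, κ m z = 1 := by
      rw [Finset.sum_comm, ← htot]
      simp_rw [hκ]
    calc ∑ i, w i * y₂ i
        = ∑ m, ∑ z, ∑ s, (∑ p, ∑ q, α m z p s q * β z p s q) *
            (γ m z s / (∑ m, γ m z s) * ((∑ m, κ m z) / κ m z)) := by
          simp only [w, y₂, Fintype.sum_prod_type]
          simp_rw [Finset.sum_comm (s := (Finset.univ : Finset P)) (t := (Finset.univ : Finset S)),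
            Finset.sum_mul]
      _ ≤ ∑ m, ∑ z, ∑ s, γ m z s / (∑ m, γ m z s) * (∑ m, κ m z) := by
          refine Finset.sum_le_sum fun m _ => Finset.sum_le_sum fun z _ =>
            Finset.sum_le_sum fun s _ => ?_
          have h1 : ∑ p, ∑ q, α m z p s q * β z p s q ≤ κ m z := by
            rw [hκ]
            gcongr with p _
            exact Finset.single_le_sum (f := fun s => ∑ q, α m z p s q * β z p s q)
              (fun s _ => Finset.sum_nonneg fun q _ => mul_nonneg (hα _ _ _ _ _) (hβ _ _ _ _))
              (Finset.mem_univ s)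
          have hg : 0 ≤ ∑ m, γ m z s := Finset.sum_nonneg fun m _ => hγ m z s
          have hk : 0 ≤ ∑ m, κ m z := Finset.sum_nonneg fun m _ => hκ0 m z
          have h2 : 0 ≤ γ m z s / (∑ m, γ m z s) * (∑ m, κ m z) :=
            mul_nonneg (div_nonneg (hγ _ _ _) hg) hk
          calc (∑ p, ∑ q, α m z p s q * β z p s q) *
                (γ m z s / (∑ m, γ m z s) * ((∑ m, κ m z) / κ m z))
              ≤ κ m z * (γ m z s / (∑ m, γ m z s) * ((∑ m, κ m z) / κ m z)) :=
                mul_le_mul_of_nonneg_right h1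
                  (mul_nonneg (div_nonneg (hγ _ _ _) hg) (div_nonneg hk (hκ0 _ _)))
            _ = (κ m z / κ m z) * (γ m z s / (∑ m, γ m z s) * (∑ m, κ m z)) := by ring
            _ ≤ 1 * (γ m z s / (∑ m, γ m z s) * (∑ m, κ m z)) :=
                mul_le_mul_of_nonneg_right (div_self_le_one _) h2
            _ = _ := one_mul _
      _ = ∑ s, ∑ z, (∑ m, γ m z s) / (∑ m, γ m z s) * (∑ m, κ m z) := by
          simp_rw [Finset.sum_comm (s := (Finset.univ : Finset Z)) (t := (Finset.univ : Finset S))]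
          simp_rw [Finset.sum_comm (s := (Finset.univ : Finset M)) (t := (Finset.univ : Finset S)),
            Finset.sum_comm (s := (Finset.univ : Finset M)) (t := (Finset.univ : Finset Z)),
            ← Finset.sum_mul, ← Finset.sum_div]
      _ ≤ ∑ s : S, ∑ z, 1 * ∑ m, κ m z := by
          gcongr with s _ z _
          · exact Finset.sum_nonneg fun m _ => hκ0 m z
          · exact div_self_le_one _
      _ = Fintype.card S := by simp [hz1]
  have hJ₁ := sum_mul_log_le_log hw hw1 (by exact_mod_cast Fintype.card_pos)
    (fun ⟨m, z, p, s, q⟩ h => by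
      obtain ⟨h1, h2, h3, h4, -, -⟩ := hpos m z p s q h
      exact div_pos h4 (h2 ▸ h1)) hsum₁
  have hJ₂ := sum_mul_log_le_log hw hw1 (by exact_mod_cast Fintype.card_pos)
    (fun ⟨m, z, p, s, q⟩ h => by
      obtain ⟨-, -, h3, h4, h5, h6⟩ := hpos m z p s q h
      exact mul_pos (div_pos h3 h4) (div_pos h6 h5)) hsum₂
  calc ∑ m, ∑ z, κ m z * Real.log ((∑ m', κ m' z) / κ m z)
      = ∑ i : M × Z × P × S × Q, w i * Real.log ((∑ m, κ m i.2.1) / κ i.1 i.2.1) := by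
        simp only [w, Fintype.sum_prod_type]
        refine Finset.sum_congr rfl fun m _ => Finset.sum_congr rfl fun z _ => ?_
        simp_rw [← Finset.sum_mul]
        rw [hκ m z]
    _ ≤ ∑ i, (w i * Real.log (y₁ i) + w i * Real.log (y₂ i)) := by
        refine Finset.sum_le_sum fun ⟨m, z, p, s, q⟩ _ => ?_
        rcases (hw (m, z, p, s, q)).eq_or_lt with h | h
        · simp [← h]
        obtain ⟨h1, h2, h3, h4, h5, h6⟩ := hpos m z p s q h
        rw [← mul_add, ← Real.log_mul (div_pos h4 (h2 ▸ h1)).ne'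
          (mul_pos (div_pos h3 h4) (div_pos h6 h5)).ne']
        refine mul_le_mul_of_nonneg_left (Real.log_le_log (div_pos h6 h5) ?_) h.le
        simp only [h2]
        have : (∑ m, γ m z s) / α m z p s q *
            (γ m z s / (∑ m, γ m z s) * ((∑ m, κ m z) / κ m z)) =
            γ m z s / α m z p s q * ((∑ m, κ m z) / κ m z) := by
          field_simp
        rw [this]
        exact le_mul_of_one_le_left (div_pos h6 h5).le ((one_le_div h1).2 (hαγ _ _ _ _ _))
    _ ≤ _ := by
        rw [Finset.sum_add_distrib]
        exact add_le_add hJ₁ hJ₂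

/-! ### Sets of rows with few neighbours -/

/-- Deficiency form of Hall's theorem in terms of ranks: if all matrices supported on the relation
`r` (with rows in `R`) have rank at most `k`, then some set of rows has few neighbours. -/
theorem exists_card_neighbors_le_of_rank_le {m n F : Type*} [Fintype n] [DecidableEq n]
    [DecidableEq m] [Field F] (r : m → n → Prop) [∀ i, DecidablePred (r i)] (R : Finset m) (k : ℕ)
    (hk : ∀ U : Matrix {i // i ∈ R} n F, (∀ i j, ¬ r i.1 j → U i j = 0) → U.rank ≤ k) :
    ∃ R' ⊆ R, (R'.biUnion fun i => Finset.univ.filter (r i)).card + R.card ≤ k + R'.card := by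
  classical
  by_contra! hcon
  have hkR : k < R.card := by simpa using hcon ∅ (by simp)
  -- with `R.card - k - 1` dummy columns, adjacent to all rows, Hall's condition is satisfied
  let t : {i // i ∈ R} → Finset (n ⊕ Fin (R.card - k - 1)) := fun i =>
    (Finset.univ.filter (r i.1)).disjSum Finset.univ
  obtain ⟨f, hf, hft⟩ := (Finset.all_card_le_biUnion_card_iff_exists_injective t).1 (by
    intro s
    rcases s.eq_empty_or_nonempty with rfl | ⟨i₀, hi₀⟩
    · simp
    have h1 := hcon (s.map (Function.Embedding.subtype _)) (by
      intro i hi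
      simp only [Finset.mem_map, Function.Embedding.subtype_apply] at hi
      obtain ⟨a, -, rfl⟩ := hi
      exact a.2)
    rw [Finset.card_map] at h1
    have h2 : ((s.map (Function.Embedding.subtype _)).biUnion
        fun i => Finset.univ.filter (r i)).disjSum Finset.univ ⊆ s.biUnion t := by
      intro x hx
      rw [Finset.mem_biUnion]
      rcases x with x | x
      · simp only [Finset.inl_mem_disjSum, Finset.mem_biUnion, Finset.mem_map,
          Function.Embedding.subtype_apply] at hx
        obtain ⟨_, ⟨i, hi, rfl⟩, hx⟩ := hx
        exact ⟨i, hi, by simpa [t] using hx⟩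
      · exact ⟨i₀, hi₀, by simp [t]⟩
    have h3 := Finset.card_le_card h2
    rw [Finset.card_disjSum, Finset.card_univ, Fintype.card_fin] at h3
    omega)
  let U : Matrix {i // i ∈ R} n F := Matrix.of fun i j => if f i = Sum.inl j then 1 else 0
  have hU := hk U (fun i j hij => by
    simp only [U, Matrix.of_apply, ite_eq_right_iff]
    intro h
    have := hft i
    rw [h] at this
    simp only [t, Finset.inl_mem_disjSum, Finset.mem_filter, Finset.mem_univ, true_and] at this
    exact absurd this hij)
  have hUU : U * U.transpose = Matrix.diagonal fun i => if (f i).isLeft then (1 : F) else 0 := by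
    ext i i'
    rw [Matrix.mul_apply]
    simp only [U, Matrix.transpose_apply, Matrix.of_apply, Matrix.diagonal_apply]
    rcases hi : f i with j | j
    · rw [Finset.sum_eq_single j]
      · by_cases hii : i = i'
        · subst hii; simp [hi]
        · have : f i' ≠ Sum.inl j := fun h => hii (hf (hi.trans h.symm))
          simp [hii, this]
      · intro j' _ hj'
        simp [hj'.symm]
      · simp
    · simp
  have hrank := (Matrix.rank_mul_le_left U U.transpose).trans hU
  rw [hUU, Matrix.rank_diagonal] at hrank
  have h1 : Fintype.card {i // (if (f i).isLeft then (1 : F) else 0) ≠ 0} +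
      Fintype.card {i // ¬ (if (f i).isLeft then (1 : F) else 0) ≠ 0} = R.card := by
    rw [← Fintype.card_sum, Fintype.card_congr (Equiv.sumCompl _), Fintype.card_coe]
  have h2 : Fintype.card {i // ¬ (if (f i).isLeft then (1 : F) else 0) ≠ 0} ≤ R.card - k - 1 := by
    have hr : ∀ i : {i // ¬ (if (f i).isLeft then (1 : F) else 0) ≠ 0}, (f i.1).isRight := by
      rintro ⟨i, hi⟩
      rcases h : f i with j | j
      · simp [h] at hi
      · simp
    have := Fintype.card_le_of_injective (fun i => (f i.1).getRight (hr i)) (by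
      intro i i' h
      apply Subtype.ext
      apply hf
      rw [← Sum.inr_getRight (f i.1) (hr i), ← Sum.inr_getRight (f i'.1) (hr i')]
      exact congrArg _ h)
    simpa using this
  omega

/-! ### Networks in which some edges are forced -/

namespace Network

variable {V E : Type*}

/-- `N.Feeds p' p`: the signal sent on the edge `p'.1` in step `p'.2` is received by the tail
of the edge `p.1` in time to be used in step `p.2`. -/
def Feeds (N : Network V E) {T : ℕ} (p' p : E × Fin T) : Prop :=
  N.head p'.1 = N.tail p.1 ∧ (p'.2 : ℕ) + N.delay p'.1 ≤ (p.2 : ℕ)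

theorem wellFounded_feeds [Finite E] (N : Network V E) (T : ℕ) :
    WellFounded (N.Feeds (T := T)) := by
  have key : ∀ p p' : E × Fin T, Relation.TransGen N.Feeds p p' → p.2 ≤ p'.2 ∧
      (p.2 = p'.2 → Relation.TransGen (fun u w => ∃ e, N.tail e = u ∧ N.head e = w ∧ N.delay e = 0)
        (N.tail p.1) (N.tail p'.1)) := by
    have step : ∀ p p' : E × Fin T, N.Feeds p p' → p.2 ≤ p'.2 ∧
        (p.2 = p'.2 → ∃ e, N.tail e = N.tail p.1 ∧ N.head e = N.tail p'.1 ∧ N.delay e = 0) := by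
      rintro p p' ⟨h1, h2⟩
      refine ⟨Fin.le_def.2 (by omega), fun h => ⟨p.1, rfl, h1, ?_⟩⟩
      rw [h] at h2
      omega
    intro p p' h
    induction h with
    | single h => exact ⟨(step _ _ h).1, fun h' => .single ((step _ _ h).2 h')⟩
    | tail _ h ih =>
      refine ⟨ih.1.trans (step _ _ h).1, fun h' => ?_⟩
      have h1 := le_antisymm ih.1 (h' ▸ (step _ _ h).1)
      exact (ih.2 h1).tail ((step _ _ h).2 (h1 ▸ h'))
  have : Std.Irrefl (Relation.TransGen (N.Feeds (T := T))) :=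
    ⟨fun p h => N.causal _ ((key p p h).2 rfl)⟩
  have h := Finite.wellFounded_of_trans_of_irrefl (Relation.TransGen (N.Feeds (T := T)))
  exact Subrelation.wf (fun h => Relation.TransGen.single h) h

namespace SecureCode

variable [Fintype V] [Fintype E] [DecidableEq E] {N : Network V E} {𝒜 : Set (Finset E)}
  (c : N.SecureCode 𝒜)

attribute [local instance] SecureCode.measΩ SecureCode.prob SecureCode.measKey

/-- The constant zero signal on all edges. -/
def zeroSignal : E → Fin c.T → Fin c.q := fun _ _ => ⟨0, two_pos.trans_le c.two_le_q⟩

open Classical in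
/-- The signals when the message is replaced by `m` and the edges in `C` are made to carry the
signals `x` instead of those that the encoders produce. The values of `x` outside of `C` are
irrelevant. -/
noncomputable def forced (C : Set E) (x : E → Fin c.T → Fin c.q) (m : Fin c.m) (ω : c.Ω) :
    E × Fin c.T → Fin c.q :=
  (N.wellFounded_feeds c.T).fix fun p rec =>
    if p.1 ∈ C then x p.1 p.2 else
      c.enc p.1 p.2 (if N.tail p.1 = N.source then some m else none) (c.K (N.tail p.1) ω)
        (fun p' => rec p'.1 p'.2)

variable {c} {C : Set E} {x : E → Fin c.T → Fin c.q} {m : Fin c.m} {ω : c.Ω} {e : E}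

theorem forced_of_mem (h : e ∈ C) (t : Fin c.T) : c.forced C x m ω (e, t) = x e t := by
  rw [forced, WellFounded.fix_eq]
  simp [h]

open Classical in
theorem forced_of_notMem (h : e ∉ C) (t : Fin c.T) : c.forced C x m ω (e, t) =
    c.enc e t (if N.tail e = N.source then some m else none) (c.K (N.tail e) ω)
      (fun p => c.forced C x m ω p.1) := by
  rw [forced, WellFounded.fix_eq]
  simp only [h, if_false]

open Classical in
/-- On a set `D` of edges that contains, with each unforced edge, all edges that enter its tail, the
forced signals are the only solution of the network equations. -/
theorem forced_eq (D : Set E) (y : E → Fin c.T → Fin c.q)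
    (hC : ∀ e ∈ D, e ∈ C → x e = y e)
    (hD : ∀ e ∈ D, e ∉ C → ∀ e', N.head e' = N.tail e → e' ∈ D)
    (hy : ∀ e ∈ D, e ∉ C → ∀ t, y e t = c.enc e t (if N.tail e = N.source then some m else none)
      (c.K (N.tail e) ω) (fun p => y p.1.1 p.1.2)) (he : e ∈ D) (t : Fin c.T) :
    c.forced C x m ω (e, t) = y e t := by
  suffices ∀ p : E × Fin c.T, p.1 ∈ D → c.forced C x m ω p = y p.1 p.2 from this (e, t) he
  intro p
  induction p using (N.wellFounded_feeds c.T).induction with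
  | _ p ih =>
    obtain ⟨e, t⟩ := p
    intro he
    by_cases h : e ∈ C
    · rw [forced_of_mem h, hC e he h]
    · rw [forced_of_notMem h, hy e he h]
      congr 1
      funext p'
      exact ih p'.1 p'.2 (hD e he h _ p'.2.1)

/-- Forcing edges to carry what they carry anyway changes nothing. -/
theorem forced_eq_X (h : ∀ e ∈ C, ∀ t, x e t = c.X e t ω) (e : E) (t : Fin c.T) :
    c.forced C x (c.M ω) ω (e, t) = c.X e t ω :=
  forced_eq Set.univ (fun e t => c.X e t ω) (fun e _ he => funext (h e he)) (by simp)
    (fun e _ _ t => c.X_eq e t ω) (Set.mem_univ e) t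

/-- The σ-algebra generated by the keys of the nodes in `D`. -/
@[reducible]
def keySigma (c : N.SecureCode 𝒜) (D : Set V) : MeasurableSpace c.Ω :=
  ⨆ v ∈ D, (c.measKey v).comap (c.K v)

theorem keySigma_le (c : N.SecureCode 𝒜) (D : Set V) : c.keySigma D ≤ c.measΩ :=
  iSup₂_le fun v _ => (c.measurable_K v).comap_le

theorem measurable_K_keySigma {D : Set V} {v : V} (hv : v ∈ D) :
    Measurable[c.keySigma D] (c.K v) :=
  (comap_measurable (c.K v)).mono (le_iSup₂_of_le v hv le_rfl) le_rfl

/-- If all edges that enter `D` are forced, then the signals sent by the nodes of `D` are functions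
of the keys of these nodes. -/
theorem measurable_forced {D : Set V} (hD : ∀ e, N.head e ∈ D → N.tail e ∈ D ∨ e ∈ C)
    (he : N.tail e ∈ D) (t : Fin c.T) :
    Measurable[c.keySigma D] fun ω => c.forced C x m ω (e, t) := by
  suffices ∀ p : E × Fin c.T, (N.tail p.1 ∈ D ∨ p.1 ∈ C) →
      Measurable[c.keySigma D] fun ω => c.forced C x m ω p from this (e, t) (Or.inl he)
  let _ := c.keySigma D
  intro p
  induction p using (N.wellFounded_feeds c.T).induction with
  | _ p ih =>
    obtain ⟨e, t⟩ := p
    intro he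
    by_cases h : e ∈ C
    · simp only [forced_of_mem h]
      exact @measurable_const _ _ _ _ _
    · have he : N.tail e ∈ D := he.resolve_right h
      simp only [forced_of_notMem h]
      have h1 : Measurable[c.keySigma D] fun ω => (fun p => c.forced C x m ω p.1 :
          N.Received c.T (N.tail e) t → Fin c.q) :=
        @measurable_pi_lambda _ _ _ (c.keySigma D) _ _ fun p' =>
          ih p'.1 p'.2 (hD _ (p'.2.1.symm ▸ he))
      have h2 : Measurable[c.keySigma D] (c.K (N.tail e)) := measurable_K_keySigma he
      classical
      exact (measurable_from_prod_countable_left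
        (f := fun p => c.enc e t (if N.tail e = N.source then some m else none) p.1 p.2)
        (c.measurable_enc e t _)).comp (h2.prodMk h1)

/-- The message, the keys of the nodes in `D` and those of the other nodes are independent. -/
theorem measureReal_inter_inter (c : N.SecureCode 𝒜) (D : Set V) (m : Fin c.m) {A B : Set c.Ω}
    (hA : MeasurableSet[c.keySigma D] A) (hB : MeasurableSet[c.keySigma Dᶜ] B) :
    c.μ.real (c.M ⁻¹' {m} ∩ (A ∩ B)) =
      c.μ.real (c.M ⁻¹' {m}) * (c.μ.real A * c.μ.real B) := by
  have h1 : Indep (c.keySigma D) (c.keySigma Dᶜ) c.μ :=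
    indep_iSup_of_disjoint (fun v => (c.measurable_K v).comap_le) c.indep_K disjoint_compl_right
  have h2 : ∀ D', c.keySigma D' ≤
      (MeasurableSpace.pi : MeasurableSpace (∀ v, c.Key v)).comap (fun ω v => c.K v ω) := by
    intro D'
    refine iSup₂_le fun v _ => ?_
    rw [MeasurableSpace.pi, MeasurableSpace.comap_iSup]
    refine le_iSup_of_le v ?_
    rw [MeasurableSpace.comap_comp]
    rfl
  have h3 := (IndepFun_iff_Indep _ _ _).1 c.indep_M
  have h4 := Indep_iff _ _ _ |>.1 h3 (c.M ⁻¹' {m}) (A ∩ B)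
    ⟨{m}, measurableSet_singleton m, rfl⟩ (MeasurableSet.inter (h2 _ _ hA) (h2 _ _ hB))
  have h5 := Indep_iff _ _ _ |>.1 h1 A B hA hB
  rw [measureReal_def, h4, h5, ENNReal.toReal_mul, ENNReal.toReal_mul]
  rfl

end SecureCode

end Network

/-! ### Finitely many events -/

section Events

variable {Ω : Type*} [MeasurableSpace Ω] {μ : Measure Ω} [IsProbabilityMeasure μ]

theorem sum_measureReal_inter_preimage {β : Type*} [Fintype β] [MeasurableSpace β]
    [MeasurableSingletonClass β] {Y : Ω → β} (hY : Measurable Y) (A : Set Ω) :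
    ∑ b, μ.real (A ∩ Y ⁻¹' {b}) = μ.real A := by
  have h := sum_measureReal_preimage_singleton (μ := μ.restrict A) (Finset.univ : Finset β) (f := Y)
    (fun y _ => hY (measurableSet_singleton y))
  simp only [Finset.coe_univ, Set.preimage_univ, measureReal_restrict_apply_univ] at h
  rw [← h]
  refine Finset.sum_congr rfl fun b _ => ?_
  rw [measureReal_restrict_apply (hY (measurableSet_singleton b)), Set.inter_comm]

theorem sum_measureReal_le_one {ι : Type*} [Fintype ι] {B : ι → Set Ω}
    (hB : ∀ i, MeasurableSet (B i)) (f : Ω → ι) (hf : ∀ i, ∀ ω ∈ B i, f ω = i) :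
    ∑ i, μ.real (B i) ≤ 1 := by
  have hd : Pairwise (Function.onFun Disjoint B) := fun i j hij =>
    Set.disjoint_left.2 fun ω hi hj => hij ((hf i ω hi).symm.trans (hf j ω hj))
  rw [← measureReal_iUnion_fintype hd hB]
  exact measureReal_le_one

/-- If `Z` reveals nothing about `M`, then the entropy of `M` is its conditional entropy
given `Z`. -/
theorem entropy_eq_of_mutualInfo_eq_zero {α β : Type*} [Fintype α] [Fintype β] [MeasurableSpace α]
    [MeasurableSingletonClass α] [MeasurableSpace β] [MeasurableSingletonClass β]
    {M : Ω → α} {Z : Ω → β} (hM : Measurable M) (h : mutualInfo μ M Z = 0) :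
    entropy μ M = ∑ m, ∑ z, μ.real (M ⁻¹' {m} ∩ Z ⁻¹' {z}) *
      Real.log ((∑ m', μ.real (M ⁻¹' {m'} ∩ Z ⁻¹' {z})) / μ.real (M ⁻¹' {m} ∩ Z ⁻¹' {z})) := by
  have h1 : entropy μ M = entropy μ (fun ω => (M ω, Z ω)) - entropy μ Z := by
    unfold mutualInfo at h
    linarith
  have h2 : ∀ z, ∑ m, μ.real (M ⁻¹' {m} ∩ Z ⁻¹' {z}) = μ.real (Z ⁻¹' {z}) := fun z => by
    rw [← sum_measureReal_inter_preimage hM]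
    simp_rw [Set.inter_comm]
  have h3 : ∀ m z, (fun ω => (M ω, Z ω)) ⁻¹' {(m, z)} = M ⁻¹' {m} ∩ Z ⁻¹' {z} := fun m z => by
    ext ω
    simp
  rw [h1, entropy, entropy, Fintype.sum_prod_type]
  simp_rw [h3, ← h2]
  have h4 : ∀ z, Real.negMulLog (∑ m, μ.real (M ⁻¹' {m} ∩ Z ⁻¹' {z})) =
      ∑ m, -(μ.real (M ⁻¹' {m} ∩ Z ⁻¹' {z}) *
        Real.log (∑ m', μ.real (M ⁻¹' {m'} ∩ Z ⁻¹' {z}))) := fun z => by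
    rw [Real.negMulLog, neg_mul, Finset.sum_mul, Finset.sum_neg_distrib]
  simp_rw [h4]
  rw [Finset.sum_comm (s := (Finset.univ : Finset β)), ← Finset.sum_sub_distrib]
  refine Finset.sum_congr rfl fun m _ => ?_
  rw [← Finset.sum_sub_distrib]
  refine Finset.sum_congr rfl fun z _ => ?_
  rcases (measureReal_nonneg (μ := μ) (s := M ⁻¹' {m} ∩ Z ⁻¹' {z})).eq_or_lt with h0 | h0
  · simp [← h0]
  · have h5 : 0 < ∑ m', μ.real (M ⁻¹' {m'} ∩ Z ⁻¹' {z}) := h0.trans_le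
      (Finset.single_le_sum (f := fun m' => μ.real (M ⁻¹' {m'} ∩ Z ⁻¹' {z}))
        (fun _ _ => measureReal_nonneg) (Finset.mem_univ m))
    rw [Real.log_div h5.ne' h0.ne', Real.negMulLog]
    ring

end Events

/-! ### Cuts with some edges forced -/

namespace Network

variable {V E : Type*}

/-- The forward edges of the cut `W`, as a set of edges. -/
def fwd (N : Network V E) (W : Finset V) : Set E := {e | N.tail e ∈ W ∧ N.head e ∉ W}

/-- The backward edges of the cut `W`, as a set of edges. -/
def bwd (N : Network V E) (W : Finset V) : Set E := {e | N.tail e ∉ W ∧ N.head e ∈ W}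

/-- The edges in `G`, and those that enter `W` or stay in it and from which an edge in `G` can be
reached inside `W`. -/
def ancestors (N : Network V E) (W : Finset V) (G : Set E) : Set E :=
  {e | e ∈ G ∨ N.head e ∈ W ∧ ∃ g ∈ G, N.PathInside W (N.head e) (N.tail g)}

theorem mem_ancestors_of_head_eq_tail {N : Network V E} {W : Finset V} {G : Set E} {e e' : E}
    (he : e ∈ N.ancestors W G) (hW : N.tail e ∈ W) (h : N.head e' = N.tail e) :
    e' ∈ N.ancestors W G := by
  refine Or.inr ⟨h ▸ hW, ?_⟩
  rcases he with he | ⟨h1, g, hg, hp⟩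
  · exact ⟨e, he, h ▸ Relation.ReflTransGen.refl⟩
  · exact ⟨g, hg, hp.head ⟨h ▸ hW, h1, e, h.symm, rfl⟩⟩

namespace SecureCode

variable [Fintype V] [Fintype E] [DecidableEq E] {N : Network V E} {𝒜 : Set (Finset E)}
  {c : N.SecureCode 𝒜} {W : Finset V} {x x' : E → Fin c.T → Fin c.q} {m : Fin c.m} {ω : c.Ω}

attribute [local instance] SecureCode.measΩ SecureCode.prob SecureCode.measKey

/-- If the backward edges are forced, then the signals on the edges in `G` depend only on the
backward edges from which `G` can be reached. -/
theorem forced_bwd_congr {G : Set E} (hG : ∀ g ∈ G, N.tail g ∈ W)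
    (h : ∀ e ∈ N.bwd W, e ∈ N.ancestors W G → x e = x' e) {g : E} (hg : g ∈ G) (t : Fin c.T) :
    c.forced (N.bwd W) x m ω (g, t) = c.forced (N.bwd W) x' m ω (g, t) := by
  have htail : ∀ e ∈ N.ancestors W G, e ∉ N.bwd W → N.tail e ∈ W := by
    rintro e (he | he) hb
    · exact hG e he
    · by_contra hW
      exact hb ⟨hW, he.1⟩
  refine forced_eq (N.ancestors W G) (fun e t => c.forced (N.bwd W) x' m ω (e, t)) ?_ ?_ ?_
    (Or.inl hg) t
  · intro e he hb
    funext t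
    rw [forced_of_mem hb, h e hb he]
  · intro e he hb e' he'
    exact mem_ancestors_of_head_eq_tail he (htail e he hb) he'
  · intro e he hb t
    exact forced_of_notMem hb t

/-- The interaction of the two sides of the cut. Let the edges in `P` be forced to carry `x`. If the
side of the source, being told that `x` is what it receives, sends `x` on the other forward
edges, and the side of the sink, being told that `x` is what it receives, answers with `x` on all
backward edges that matter for these forward edges, then `x` is what the forward edges carry, and
the side of the sink sends what it sends when all forward edges are forced to carry `x`. -/
theorem forced_eq_forced_fwd (hS : N.source ∈ W) {P : Set E} (hP : P ⊆ N.fwd W)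
    {xP : E → Fin c.T → Fin c.q} (hxP : ∀ e ∈ P, xP e = x e) {m' : Fin c.m}
    (hf : ∀ e ∈ N.fwd W, e ∉ P → ∀ t, c.forced (N.bwd W) x' m ω (e, t) = x e t)
    (hb : ∀ e ∈ N.bwd W, e ∈ N.ancestors W (N.fwd W \ P) →
      ∀ t, c.forced (N.fwd W) x m' ω (e, t) = x' e t) (e : E) (t : Fin c.T) :
    (N.tail e ∉ W → c.forced P xP m ω (e, t) = c.forced (N.fwd W) x m' ω (e, t)) ∧
      (e ∈ N.fwd W → c.forced P xP m ω (e, t) = x e t) := by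
  classical
  let D : Set E := {e | N.tail e ∉ W ∨ e ∈ P ∨ e ∈ N.ancestors W (N.fwd W \ P)}
  let y : E → Fin c.T → Fin c.q := fun e t =>
    if N.tail e ∉ W then c.forced (N.fwd W) x m' ω (e, t)
    else if e ∈ P then x e t else c.forced (N.bwd W) x' m ω (e, t)
  have key : ∀ e ∈ D, ∀ t, c.forced P xP m ω (e, t) = y e t := by
    intro e he t
    refine forced_eq D y ?_ ?_ ?_ he t
    · intro e _ hP'
      rw [hxP e hP']
      funext t
      simp [y, (hP hP').1, hP']
    · intro e he heP e' he'
      by_cases hW' : N.tail e' ∈ W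
      swap
      · exact Or.inl hW'
      by_cases hW : N.tail e ∈ W
      · exact Or.inr (Or.inr (mem_ancestors_of_head_eq_tail
          ((he.resolve_left (not_not.2 hW)).resolve_left heP) hW he'))
      · by_cases heP' : e' ∈ P
        · exact Or.inr (Or.inl heP')
        · exact Or.inr (Or.inr (Or.inl ⟨⟨hW', he'.symm ▸ hW⟩, heP'⟩))
    · intro e he heP t
      by_cases hW : N.tail e ∈ W
      · have hanc : e ∈ N.ancestors W (N.fwd W \ P) :=
          (he.resolve_left (not_not.2 hW)).resolve_left heP
        simp only [y, hW, not_true, if_false, heP]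
        rw [forced_of_notMem (fun h => h.1 hW)]
        congr 1
        funext ⟨⟨e', t'⟩, he', ht'⟩
        dsimp only at he' ⊢
        by_cases hW' : N.tail e' ∈ W
        · have : e' ∉ P := fun h => (hP h).2 (he'.symm ▸ hW)
          simp [hW', this]
        · have hb' : e' ∈ N.bwd W := ⟨hW', he'.symm ▸ hW⟩
          simp only [hW', not_false_eq_true, if_true]
          rw [forced_of_mem hb', hb e' hb' (mem_ancestors_of_head_eq_tail hanc hW he')]
      · have hs : N.tail e ≠ N.source := fun h => hW (h ▸ hS)
        simp only [y, hW, not_false_eq_true, if_true]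
        rw [forced_of_notMem (fun h => hW h.1)]
        simp only [hs, if_false]
        congr 1
        funext ⟨⟨e', t'⟩, he', ht'⟩
        dsimp only at he' ⊢
        by_cases hW' : N.tail e' ∈ W
        · have hf' : e' ∈ N.fwd W := ⟨hW', he'.symm ▸ hW⟩
          rw [forced_of_mem hf']
          by_cases hP' : e' ∈ P
          · simp [hW', hP']
          · simp [hW', hP', hf e' hf' hP']
        · simp [hW']
  constructor
  · intro hW
    rw [key e (Or.inl hW)]
    simp [y, hW]
  · intro he
    by_cases heP : e ∈ P
    · rw [key e (Or.inr (Or.inl heP))]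
      simp [y, he.1, heP]
    · rw [key e (Or.inr (Or.inr (Or.inl ⟨he, heP⟩)))]
      simp [y, he.1, heP, hf e he heP]

/-- If both sides of the cut, each being told that `x` is what it receives, answer with `x`, then
`x` is what the edges of the cut carry. -/
theorem X_eq_of_forced (hS : N.source ∈ W) {m' : Fin c.m}
    (hf : ∀ e ∈ N.fwd W, ∀ t, c.forced (N.bwd W) x (c.M ω) ω (e, t) = x e t)
    (hb : ∀ e ∈ N.bwd W, ∀ t, c.forced (N.fwd W) x m' ω (e, t) = x e t) (e : E) (t : Fin c.T) :
    (N.tail e ∉ W → c.X e t ω = c.forced (N.fwd W) x m' ω (e, t)) ∧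
      (e ∈ N.fwd W → c.X e t ω = x e t) := by
  have := forced_eq_forced_fwd (c := c) (P := ∅) (xP := x) (x := x) (x' := x) (m := c.M ω)
    (m' := m') hS (by simp) (by simp) (fun e he _ => hf e he) (fun e he _ => hb e he) e t
  rwa [forced_eq_X (by simp)] at this

/-- Being told what it receives anyway, the side of the sink sends what it sends anyway. -/
theorem forced_fwd_eq_X (hS : N.source ∈ W) {m' : Fin c.m}
    (h : ∀ e ∈ N.fwd W, ∀ t, x e t = c.X e t ω) {e : E} (he : N.tail e ∉ W) (t : Fin c.T) :
    c.forced (N.fwd W) x m' ω (e, t) = c.X e t ω := by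
  refine forced_eq ({e | N.tail e ∉ W} ∪ N.fwd W) (fun e t => c.X e t ω)
    (fun e _ he => funext (h e he)) ?_ ?_ (Or.inl he) t
  · intro e he hf e' he'
    by_cases hW' : N.tail e' ∈ W
    · exact Or.inr ⟨hW', he'.symm ▸ he.resolve_right hf⟩
    · exact Or.inl hW'
  · intro e he hf t
    have hs : N.tail e ≠ N.source := fun h => he.resolve_right hf (h ▸ hS)
    rw [c.X_eq]
    simp only [hs, if_false]

/-- The event that the signals on the edges in `G` are `x`, given the message `m` and given that
the edges in `C` are forced to carry `x'`. -/
def forcedEvent (c : N.SecureCode 𝒜) (C G : Set E) (x' x : E → Fin c.T → Fin c.q) (m : Fin c.m) :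
    Set c.Ω :=
  {ω | ∀ e ∈ G, ∀ t, c.forced C x' m ω (e, t) = x e t}

theorem measurableSet_forcedEvent {C G : Set E} {D : Set V}
    (hD : ∀ e, N.head e ∈ D → N.tail e ∈ D ∨ e ∈ C) (hG : ∀ e ∈ G, N.tail e ∈ D) :
    MeasurableSet[c.keySigma D] (c.forcedEvent C G x' x m) := by
  have : c.forcedEvent C G x' x m = ⋂ e, ⋂ (_ : e ∈ G), ⋂ t,
      (fun ω => c.forced C x' m ω (e, t)) ⁻¹' {x e t} := by
    ext ω
    simp [forcedEvent]
  rw [this]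
  exact MeasurableSet.iInter fun e => MeasurableSet.iInter fun he => MeasurableSet.iInter fun t =>
    measurable_forced hD (hG e he) t (measurableSet_singleton _)

theorem measurableSet_forcedEvent_bwd {G : Set E} (hG : ∀ e ∈ G, N.tail e ∈ W) :
    MeasurableSet[c.keySigma W] (c.forcedEvent (N.bwd W) G x' x m) :=
  measurableSet_forcedEvent (fun e he => by
    by_cases h : N.tail e ∈ W
    · exact Or.inl h
    · exact Or.inr ⟨h, he⟩) hG

theorem measurableSet_forcedEvent_fwd {G : Set E} (hG : ∀ e ∈ G, N.tail e ∉ W) :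
    MeasurableSet[c.keySigma (W : Set V)ᶜ] (c.forcedEvent (N.fwd W) G x' x m) :=
  measurableSet_forcedEvent (fun e he => by
    by_cases h : N.tail e ∈ W
    · exact Or.inr ⟨h, he⟩
    · exact Or.inl h) hG

theorem measurable_X (c : N.SecureCode 𝒜) (e : E) (t : Fin c.T) : Measurable (c.X e t) := by
  have h1 : ∀ m, Measurable fun ω => c.forced ∅ c.zeroSignal m ω (e, t) := fun m =>
    (measurable_forced (D := Set.univ) (by simp) (Set.mem_univ _) t).mono (c.keySigma_le _) le_rfl
  have h2 : c.X e t = (fun p : Fin c.m × c.Ω => c.forced ∅ c.zeroSignal p.1 p.2 (e, t)) ∘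
      fun ω => (c.M ω, ω) := by
    funext ω
    exact (forced_eq_X (by simp) e t).symm
  rw [h2]
  exact (measurable_from_prod_countable_right h1).comp (c.measurable_M.prodMk measurable_id)

/-- Two messages that the side of the source can turn into the same forward signals `x` cannot be
told apart by the side of the sink. -/
theorem eq_of_forcedEvent (hS : N.source ∈ W) (hD : N.sink ∉ W) {m₀ m₁ m₂ : Fin c.m}
    (h₁ : c.μ.real (c.M ⁻¹' {m₁}) * c.μ.real (c.forcedEvent (N.bwd W) (N.fwd W) x x m₁) ≠ 0)
    (h₂ : c.μ.real (c.M ⁻¹' {m₂}) * c.μ.real (c.forcedEvent (N.bwd W) (N.fwd W) x x m₂) ≠ 0)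
    (hB : c.μ.real (c.forcedEvent (N.fwd W) (N.bwd W) x x m₀) ≠ 0) : m₁ = m₂ := by
  by_contra hne
  set B := c.forcedEvent (N.fwd W) (N.bwd W) x x m₀ with hBdef
  have hBm : MeasurableSet[c.keySigma (W : Set V)ᶜ] B :=
    measurableSet_forcedEvent_fwd fun e he => he.1
  -- what the sink decodes when the forward edges are forced to carry `x`
  let d : c.Ω → Fin c.m := fun ω =>
    c.dec (c.K N.sink ω) (fun e t => c.forced (N.fwd W) x m₀ ω (e.1, t))
  have hd : ∀ m, MeasurableSet[c.keySigma (W : Set V)ᶜ] (d ⁻¹' {m}ᶜ) := by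
    intro m
    have h1 : Measurable[c.keySigma (W : Set V)ᶜ] fun ω =>
        (fun e t => c.forced (N.fwd W) x m₀ ω (e.1, t) :
          {e : E // N.head e = N.sink} → Fin c.T → Fin c.q) := by
      refine @measurable_pi_lambda _ _ _ (c.keySigma _) _ _ fun e =>
        @measurable_pi_lambda _ _ _ (c.keySigma _) _ _ fun t => ?_
      by_cases he : N.tail e.1 ∈ W
      · have : e.1 ∈ N.fwd W := ⟨he, e.2.symm ▸ hD⟩
        simp only [forced_of_mem this]
        exact @measurable_const _ _ _ (c.keySigma _) _
      · refine measurable_forced (fun e he => ?_) (by simpa using he) t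
        by_cases h : N.tail e ∈ W
        · exact Or.inr ⟨h, he⟩
        · exact Or.inl h
    have h2 : Measurable[c.keySigma (W : Set V)ᶜ] (c.K N.sink) :=
      measurable_K_keySigma (by simpa using hD)
    let _ := c.keySigma (W : Set V)ᶜ
    exact ((measurable_from_prod_countable_left (f := fun p => c.dec p.1 p.2)
      c.measurable_dec).comp (h2.prodMk h1))
      (measurableSet_singleton m).compl
  have key : ∀ m, c.μ.real (c.M ⁻¹' {m}) *
      c.μ.real (c.forcedEvent (N.bwd W) (N.fwd W) x x m) ≠ 0 → c.μ.real (B ∩ d ⁻¹' {m}ᶜ) = 0 := by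
    intro m hm
    have h1 := c.measureReal_inter_inter W m (A := c.forcedEvent (N.bwd W) (N.fwd W) x x m)
      (B := B ∩ d ⁻¹' {m}ᶜ) (measurableSet_forcedEvent_bwd fun e he => he.1)
      (@MeasurableSet.inter _ (c.keySigma _) _ _ hBm (hd m))
    have h2 : c.μ.real (c.M ⁻¹' {m} ∩
        (c.forcedEvent (N.bwd W) (N.fwd W) x x m ∩ (B ∩ d ⁻¹' {m}ᶜ))) = 0 := by
      rw [measureReal_def, measure_mono_null _ (ae_iff.1 c.decodes)]
      · rfl
      rintro ω ⟨rfl, hω1, hω2, hω3⟩ hω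
      have hX := X_eq_of_forced hS hω1 hω2
      refine hω3 (Eq.trans ?_ hω)
      simp only [d]
      congr 1
      funext e t
      by_cases he : N.tail e.1 ∈ W
      · have : e.1 ∈ N.fwd W := ⟨he, e.2.symm ▸ hD⟩
        rw [forced_of_mem this, (hX e.1 t).2 this]
      · exact ((hX e.1 t).1 he).symm
    rw [h1, ← mul_assoc] at h2
    exact (mul_eq_zero.1 h2).resolve_left hm
  refine hB (le_antisymm ?_ measureReal_nonneg)
  calc c.μ.real B ≤ c.μ.real ((B ∩ d ⁻¹' {m₁}ᶜ) ∪ (B ∩ d ⁻¹' {m₂}ᶜ)) := by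
        refine measureReal_mono fun ω hω => ?_
        by_cases h : d ω = m₁
        · exact Or.inr ⟨hω, fun h' => hne (h.symm.trans h')⟩
        · exact Or.inl ⟨hω, h⟩
    _ ≤ _ := measureReal_union_le _ _
    _ = 0 := by rw [key m₁ h₁, key m₂ h₂, add_zero]

end SecureCode

end Network

/-! ### The entropy of the message -/

/-- The function on `E` with prescribed restrictions to `A`, `P`, `S` and `Q` (if these sets
overlap, the first one counts), and the value `u` elsewhere. -/
def glue {E U : Type*} [DecidableEq E] {A P S Q : Finset E} (u : U) (a : A → U) (p : P → U)
    (s : S → U) (q : Q → U) (e : E) : U :=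
  if h : e ∈ A then a ⟨e, h⟩ else if h : e ∈ P then p ⟨e, h⟩ else
    if h : e ∈ S then s ⟨e, h⟩ else if h : e ∈ Q then q ⟨e, h⟩ else u

namespace Network.SecureCode

variable {V E : Type*} [Fintype V] [Fintype E] [DecidableEq E] {N : Network V E}
  {𝒜 : Set (Finset E)} (c : N.SecureCode 𝒜) {W : Finset V}

attribute [local instance] SecureCode.measΩ SecureCode.prob SecureCode.measKey

theorem log_card_signals (A : Finset E) :
    Real.log (Fintype.card (A → Fin c.T → Fin c.q)) = A.card * (c.T * Real.log c.q) := by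
  simp

/-- The bound for a set `A` of wiretapped edges of the cut, the set `P` of the other forward edges,
and a set `S` of backward edges outside of `A` such that the wiretapped forward edges can be reached
only from backward edges in `A` or `S`. -/
theorem entropy_le (hS : N.source ∈ W) (hD : N.sink ∉ W) {A P S : Finset E} (hA : A ∈ 𝒜)
    (hAcut : ∀ e ∈ A, e ∈ N.fwd W ∨ e ∈ N.bwd W) (hP : ∀ e, e ∈ P ↔ e ∈ N.fwd W ∧ e ∉ A)
    (hSb : ∀ e ∈ S, e ∈ N.bwd W ∧ e ∉ A)
    (hAS : ∀ e ∈ N.bwd W, e ∈ N.ancestors W (N.fwd W \ P) → e ∈ A ∨ e ∈ S) :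
    entropy c.μ c.M ≤ (P.card + S.card) * (c.T * Real.log c.q) := by
  classical
  obtain ⟨ω₀⟩ := nonempty_of_isProbabilityMeasure c.μ
  let m₀ := c.M ω₀
  let Q : Finset E := Finset.univ.filter fun e => e ∈ N.bwd W ∧ e ∉ A ∧ e ∉ S
  have hQ : ∀ e, e ∈ Q ↔ e ∈ N.bwd W ∧ e ∉ A ∧ e ∉ S := by simp [Q]
  have hfb : ∀ e ∈ N.fwd W, e ∉ N.bwd W := fun e h h' => h'.1 h.1
  let U := Fin c.T → Fin c.q
  let u : U := fun _ => ⟨0, two_pos.trans_le c.two_le_q⟩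
  let v : (A → U) → (P → U) → (S → U) → (Q → U) → E → U := glue u
  have vA : ∀ a p s q e (h : e ∈ A), v a p s q e = a ⟨e, h⟩ := fun a p s q e h => by
    simp [v, glue, h]
  have vP : ∀ a p s q e (h : e ∈ P), v a p s q e = p ⟨e, h⟩ := fun a p s q e h => by
    simp [v, glue, h, ((hP e).1 h).2]
  have vS : ∀ a p s q e (h : e ∈ S), v a p s q e = s ⟨e, h⟩ := fun a p s q e h => by
    have : e ∉ P := fun h' => hfb e ((hP e).1 h').1 (hSb e h).1
    simp [v, glue, h, (hSb e h).2, this]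
  have vQ : ∀ a p s q e (h : e ∈ Q), v a p s q e = q ⟨e, h⟩ := fun a p s q e h => by
    have : e ∉ P := fun h' => hfb e ((hP e).1 h').1 ((hQ e).1 h).1
    simp [v, glue, h, ((hQ e).1 h).2, this]
  have hcut : ∀ e, e ∈ N.fwd W ∨ e ∈ N.bwd W → e ∈ A ∨ e ∈ P ∨ e ∈ S ∨ e ∈ Q := by
    intro e he
    by_cases heA : e ∈ A
    · exact Or.inl heA
    by_cases heS : e ∈ S
    · exact Or.inr (Or.inr (Or.inl heS))
    rcases he with he | he
    · exact Or.inr (Or.inl ((hP e).2 ⟨he, heA⟩))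
    · exact Or.inr (Or.inr (Or.inr ((hQ e).2 ⟨he, heA, heS⟩)))
  have hv : ∀ (y : E → U) a p s q, (∀ e, e ∈ N.fwd W ∨ e ∈ N.bwd W → y e = v a p s q e) ↔
      A.restrict y = a ∧ P.restrict y = p ∧ S.restrict y = s ∧ Q.restrict y = q := by
    intro y a p s q
    constructor
    · intro h
      refine ⟨?_, ?_, ?_, ?_⟩ <;> funext ⟨e, he⟩
      · exact (h e (hAcut e he)).trans (vA a p s q e he)
      · exact (h e (Or.inl ((hP e).1 he).1)).trans (vP a p s q e he)
      · exact (h e (Or.inr (hSb e he).1)).trans (vS a p s q e he)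
      · exact (h e (Or.inr ((hQ e).1 he).1)).trans (vQ a p s q e he)
    · rintro ⟨rfl, rfl, rfl, rfl⟩ e he
      rcases hcut e he with h | h | h | h
      · simp [vA _ _ _ _ e h]
      · simp [vP _ _ _ _ e h]
      · simp [vS _ _ _ _ e h]
      · simp [vQ _ _ _ _ e h]
  -- `w a s` agrees with `v a p s q` where it matters for the wiretapped forward edges
  let w : (A → U) → (S → U) → E → U := fun a s => v a (fun _ => u) s (fun _ => u)
  have hwA : ∀ a p s q e, e ∈ A → w a s e = v a p s q e := fun a p s q e h =>
    (vA _ _ _ _ e h).trans (vA _ _ _ _ e h).symm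
  have hwS : ∀ a p s q e, e ∈ S → w a s e = v a p s q e := fun a p s q e h =>
    (vS _ _ _ _ e h).trans (vS _ _ _ _ e h).symm
  let G : Set E := N.fwd W \ P
  have hGA : ∀ e ∈ G, e ∈ A := fun e he => by
    by_contra h
    exact he.2 ((hP e).2 ⟨he.1, h⟩)
  let X : c.Ω → E → U := fun ω e t => c.X e t ω
  have hX : ∀ B : Finset E, Measurable fun ω => B.restrict (X ω) := fun B =>
    measurable_pi_lambda _ fun e => measurable_pi_lambda _ fun t => c.measurable_X e.1 t
  let α : Fin c.m → (A → U) → (P → U) → (S → U) → (Q → U) → ℝ := fun m a p s q =>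
    c.μ.real (c.M ⁻¹' {m}) *
      c.μ.real (c.forcedEvent (N.bwd W) (N.fwd W) (v a p s q) (v a p s q) m)
  let β : (A → U) → (P → U) → (S → U) → (Q → U) → ℝ := fun a p s q =>
    c.μ.real (c.forcedEvent (N.fwd W) (N.bwd W) (v a p s q) (v a p s q) m₀)
  let γ : Fin c.m → (A → U) → (S → U) → ℝ := fun m a s =>
    c.μ.real (c.M ⁻¹' {m}) * c.μ.real (c.forcedEvent (N.bwd W) G (w a s) (w a s) m)
  -- the law of the message and of the signals on the cut factorizes
  have hαβ : ∀ m a p s q, α m a p s q * β a p s q =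
      c.μ.real ((c.M ⁻¹' {m} ∩ (fun ω => A.restrict (X ω)) ⁻¹' {a}) ∩
        (fun ω => (P.restrict (X ω), S.restrict (X ω), Q.restrict (X ω))) ⁻¹' {(p, s, q)}) := by
    intro m a p s q
    simp only [α, β]
    rw [mul_assoc, ← c.measureReal_inter_inter W m
      (measurableSet_forcedEvent_bwd fun e he => he.1)
      (measurableSet_forcedEvent_fwd fun e he => he.1)]
    congr 1
    ext ω
    have h1 := hv (X ω) a p s q
    simp only [Set.mem_inter_iff, Set.mem_preimage, Set.mem_singleton_iff, Prod.mk.injEq, and_assoc]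
    refine and_congr_right fun hm => ?_
    subst hm
    rw [← h1]
    constructor
    · rintro ⟨hf, hb⟩ e he
      funext t
      have h2 := X_eq_of_forced hS hf hb e t
      rcases he with he | he
      · exact h2.2 he
      · exact (h2.1 he.1).trans (hb e he t)
    · intro h
      refine ⟨fun e he t => ?_, fun e he t => ?_⟩
      · rw [forced_eq_X (fun e he t => (congrFun (h e (Or.inr he)) t).symm), h e (Or.inl he) |>.symm]
      · rw [forced_fwd_eq_X hS (fun e he t => (congrFun (h e (Or.inl he)) t).symm) he.1,
          h e (Or.inr he) |>.symm]
  have hκ : ∀ m a, c.μ.real (c.M ⁻¹' {m} ∩ (fun ω => A.restrict (X ω)) ⁻¹' {a}) =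
      ∑ p, ∑ s, ∑ q, α m a p s q * β a p s q := by
    intro m a
    rw [← sum_measureReal_inter_preimage ((hX P).prodMk ((hX S).prodMk (hX Q)))]
    simp only [hαβ, Fintype.sum_prod_type]
  have htot : ∑ m, ∑ a, ∑ p, ∑ s, ∑ q, α m a p s q * β a p s q = 1 := by
    simp_rw [← hκ, sum_measureReal_inter_preimage (hX A)]
    have := sum_measureReal_inter_preimage (μ := c.μ) c.measurable_M Set.univ
    simpa using this
  have hαγ : ∀ m a p s q, α m a p s q ≤ γ m a s := by
    intro m a p s q
    refine mul_le_mul_of_nonneg_left (measureReal_mono fun ω hω g hg t => ?_) measureReal_nonneg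
    rw [forced_bwd_congr (G := G) (x' := v a p s q) (fun g hg => hg.1.1) (fun e he he' => ?_) hg,
      hω g hg.1 t, hwA a p s q g (hGA g hg)]
    rcases hAS e he he' with h | h
    · exact hwA a p s q e h
    · exact hwS a p s q e h
  have hdec : ∀ m m' a p s q, m ≠ m' → 0 < α m a p s q * β a p s q → α m' a p s q = 0 := by
    intro m m' a p s q hne h
    by_contra h'
    exact hne (eq_of_forcedEvent hS hD (left_ne_zero_of_mul h.ne') h' (right_ne_zero_of_mul h.ne'))
  have hγβ : ∀ p, ∑ a, ∑ s, ∑ q, ∑ m, γ m a s * β a p s q ≤ 1 := by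
    intro p
    let B : (A → U) × (S → U) × (Q → U) × Fin c.m → Set c.Ω := fun i =>
      c.M ⁻¹' {i.2.2.2} ∩ (c.forcedEvent (N.bwd W) G (w i.1 i.2.1) (w i.1 i.2.1) i.2.2.2 ∩
        c.forcedEvent (N.fwd W) (N.bwd W) (v i.1 p i.2.1 i.2.2.1) (v i.1 p i.2.1 i.2.2.1) m₀)
    -- in the event `B (a, s, q, m)`, when the edges in `P` are forced to carry `p`, the other
    -- edges of the cut carry `a`, `s` and `q`
    let y : c.Ω → E → U := fun ω e t =>
      c.forced P (v (fun _ => u) p (fun _ => u) (fun _ => u)) (c.M ω) ω (e, t)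
    have hmeas : ∀ (a : A → U) (s : S → U) (q : Q → U) (m : Fin c.m),
        MeasurableSet[c.keySigma W] (c.forcedEvent (N.bwd W) G (w a s) (w a s) m) ∧
        MeasurableSet[c.keySigma (W : Set V)ᶜ]
          (c.forcedEvent (N.fwd W) (N.bwd W) (v a p s q) (v a p s q) m₀) := fun a s q m =>
      ⟨measurableSet_forcedEvent_bwd fun e he => he.1.1,
        measurableSet_forcedEvent_fwd fun e he => he.1⟩
    have h1 := sum_measureReal_le_one (μ := c.μ) (B := B)
      (fun ⟨a, s, q, m⟩ => (c.measurable_M (measurableSet_singleton m)).inter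
        ((c.keySigma_le _ _ (hmeas a s q m).1).inter (c.keySigma_le _ _ (hmeas a s q m).2)))
      (fun ω => (A.restrict (y ω), S.restrict (y ω), Q.restrict (y ω), c.M ω)) (by
        rintro ⟨a, s, q, m⟩ ω ⟨rfl, hf, hb⟩
        have hy := (hv (y ω) a p s q).1 (by
          intro e he
          funext t
          have h2 := forced_eq_forced_fwd (c := c) (x := v a p s q) (x' := w a s)
            (P := (P : Set E)) (xP := v (fun _ => u) p (fun _ => u) (fun _ => u)) (m := c.M ω)
            (m' := m₀) (ω := ω) hS (fun e he => ((hP e).1 he).1)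
            (fun e he => (vP _ _ _ _ e he).trans (vP _ _ _ _ e he).symm)
            (fun e he heP t => by
              rw [hf e ⟨he, heP⟩ t, hwA a p s q e (hGA e ⟨he, heP⟩)])
            (fun e he he' t => by
              rw [hb e he t]
              rcases hAS e he he' with h | h
              · rw [hwA a p s q e h]
              · rw [hwS a p s q e h]) e t
          rcases he with he | he
          · exact h2.2 he
          · exact (h2.1 he.1).trans (hb e he t))
        simp only [hy.1, hy.2.2.1, hy.2.2.2])
    refine le_of_eq_of_le ?_ h1
    simp only [Fintype.sum_prod_type]
    refine Finset.sum_congr rfl fun a _ => Finset.sum_congr rfl fun s _ =>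
      Finset.sum_congr rfl fun q _ => Finset.sum_congr rfl fun m _ => ?_
    rw [c.measureReal_inter_inter W m (hmeas a s q m).1 (hmeas a s q m).2, ← mul_assoc]
  have : Nonempty U := ⟨u⟩
  rw [entropy_eq_of_mutualInfo_eq_zero c.measurable_M (c.secret A hA), add_mul,
    ← c.log_card_signals, ← c.log_card_signals]
  exact sum_condEntropy_le (fun _ _ _ _ _ => mul_nonneg measureReal_nonneg measureReal_nonneg)
    (fun _ _ _ _ => measureReal_nonneg) hαγ hdec htot hγβ hκ

theorem rate_le (hS : N.source ∈ W) (hD : N.sink ∉ W) {A P S : Finset E} (hA : A ∈ 𝒜)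
    (hAcut : ∀ e ∈ A, e ∈ N.fwd W ∨ e ∈ N.bwd W) (hP : ∀ e, e ∈ P ↔ e ∈ N.fwd W ∧ e ∉ A)
    (hSb : ∀ e ∈ S, e ∈ N.bwd W ∧ e ∉ A)
    (hAS : ∀ e ∈ N.bwd W, e ∈ N.ancestors W (N.fwd W \ P) → e ∈ A ∨ e ∈ S) :
    c.rate ≤ P.card + S.card := by
  have h1 : 0 < Real.log c.q := Real.log_pos (by exact_mod_cast c.two_le_q)
  have h2 : (0 : ℝ) < c.T := by exact_mod_cast c.T_pos
  exact (div_le_iff₀ (mul_pos h2 h1)).2 (c.entropy_le hS hD hA hAcut hP hSb hAS)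

end Network.SecureCode

/-! ### Choice of the wiretapped edges -/

theorem mainTheorem2 {V E : Type*} [Fintype V] [DecidableEq V] [Fintype E] [DecidableEq E]
    (N : Network V E) (W : Finset V) (hS : N.source ∈ W) (hD : N.sink ∉ W)
    (z : ℕ) (hz : z ≤ Fintype.card (N.Fwd W) + Fintype.card (N.Bwd W))
    {F : Type*} [Field F] [Finite F] (Cbar : Matrix (N.Fwd W ⊕ N.Bwd W) (N.Bwd W) F)
    (hC : IsRankMaximized (N.connMatrix W) (N.wiretapRows W (uniformWiretap E z)) Cbar) :
    N.secrecyCapacity (uniformWiretap E z) ≤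
      (((Fintype.card (N.Fwd W) : ℝ) + (minRowRank z Cbar : ℝ) - (z : ℝ) : ℝ) : EReal) := by
  classical
  refine iSup_le fun c => EReal.coe_le_coe_iff.2 ?_
  obtain ⟨R, hRz, hRk⟩ : ∃ R : Finset (N.Fwd W ⊕ N.Bwd W), R.card = z ∧
      (rowSub Cbar R).rank = minRowRank z Cbar := by
    obtain ⟨R, -, hR⟩ := Finset.exists_subset_card_eq
      (s := (Finset.univ : Finset (N.Fwd W ⊕ N.Bwd W))) (n := z)
      (by rwa [Finset.card_univ, Fintype.card_sum])
    exact Nat.sInf_mem (s := {r | ∃ R : Finset (N.Fwd W ⊕ N.Bwd W), R.card = z ∧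
      (rowSub Cbar R).rank = r}) ⟨_, R, hR, rfl⟩
  let φ : N.Fwd W ⊕ N.Bwd W → E := Sum.elim Subtype.val Subtype.val
  have hφ : Function.Injective φ := Subtype.val_injective.sumElim Subtype.val_injective
    fun a b h => b.2.1 (h ▸ a.2.1)
  have hRrank := (hC.2 R ⟨R.image φ, Finset.card_image_le.trans hRz.le,
    fun r => (hφ.mem_finset_image (s := R)).symm⟩).2
  obtain ⟨R', hR', hcard⟩ := exists_card_neighbors_le_of_rank_le (F := F)
    (fun i j => N.connMatrix W i j ≠ 0) R (minRowRank z Cbar) (fun U hU =>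
      hRk ▸ hRrank ⟨U, fun i j h => hU i j (not_not.2 h), rfl⟩)
  let T : Finset (N.Bwd W) := R'.biUnion fun i => Finset.univ.filter fun j => N.connMatrix W i j ≠ 0
  have hT : T.card + R.card ≤ minRowRank z Cbar + R'.card := by convert hcard
  have hTmem : ∀ i ∈ R', ∀ j, N.connMatrix W i j ≠ 0 → j.1 ∈ T.image Subtype.val := fun i hi j h =>
    Finset.mem_image_of_mem _ (Finset.mem_biUnion.2 ⟨i, hi, by simpa using h⟩)
  let A : Finset E := R'.image φ
  let S : Finset E := T.image Subtype.val \ A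
  let P : Finset E := Finset.univ.filter fun e => (N.tail e ∈ W ∧ N.head e ∉ W) ∧ e ∉ A
  have hAcard : A.card = R'.card := Finset.card_image_of_injective _ hφ
  have hcount : P.card + S.card + A.card ≤ Fintype.card (N.Fwd W) + T.card := by
    have hPS : Disjoint P S := by
      rw [Finset.disjoint_left]
      intro e he he'
      obtain ⟨j, -, rfl⟩ := Finset.mem_image.1 (Finset.mem_sdiff.1 he').1
      exact j.2.1 (Finset.mem_filter.1 he).2.1.1
    have hPSA : Disjoint (P ∪ S) A := by
      rw [Finset.disjoint_left]
      intro e he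
      rcases Finset.mem_union.1 he with h | h
      · exact (Finset.mem_filter.1 h).2.2
      · exact (Finset.mem_sdiff.1 h).2
    rw [← Finset.card_union_of_disjoint hPS, ← Finset.card_union_of_disjoint hPSA]
    have hsub : P ∪ S ∪ A ⊆
        (Finset.univ : Finset (N.Fwd W)).image Subtype.val ∪ T.image Subtype.val := by
      intro e he
      rw [Finset.mem_union]
      rcases Finset.mem_union.1 he with he | he
      · rcases Finset.mem_union.1 he with he | he
        · exact Or.inl (Finset.mem_image.2
            ⟨⟨e, (Finset.mem_filter.1 he).2.1⟩, Finset.mem_univ _, rfl⟩)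
        · exact Or.inr (Finset.mem_sdiff.1 he).1
      · obtain ⟨i | j, hi, rfl⟩ := Finset.mem_image.1 he
        · exact Or.inl (Finset.mem_image_of_mem _ (Finset.mem_univ i))
        -- a backward edge is among its own neighbours: the lower part of `C` is the identity
        · exact Or.inr (hTmem _ hi j (by simp [Network.connMatrix]))
    refine (Finset.card_le_card hsub).trans ((Finset.card_union_le _ _).trans ?_)
    exact add_le_add Finset.card_image_le Finset.card_image_le
  have hrate := c.rate_le hS hD (A := A) (P := P) (S := S)
    (show A.card ≤ z from hAcard.le.trans ((Finset.card_le_card hR').trans hRz.le))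
    (fun e he => by
      obtain ⟨i | j, -, rfl⟩ := Finset.mem_image.1 he
      · exact Or.inl i.2
      · exact Or.inr j.2)
    (fun e => by simp [P, Network.fwd])
    (fun e he => by
      obtain ⟨h1, h2⟩ := Finset.mem_sdiff.1 he
      obtain ⟨j, -, rfl⟩ := Finset.mem_image.1 h1
      exact ⟨j.2, h2⟩)
    (fun e he hanc => by
      obtain h | ⟨-, g, hg, hp⟩ := hanc
      · exact absurd h.1.1 he.1
      have hgA : g ∈ A := by
        by_contra h
        exact hg.2 (by simpa [P] using ⟨hg.1, h⟩)
      obtain ⟨i | j, hi, rfl⟩ := Finset.mem_image.1 hgA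
      · have heT := hTmem _ hi ⟨e, he⟩ (by
          have : N.PathInside W (N.head e) (N.tail i.1) := hp
          simp [Network.connMatrix, Network.connBF, this])
        by_cases heA : e ∈ A
        · exact Or.inl heA
        · exact Or.inr (Finset.mem_sdiff.2 ⟨heT, heA⟩)
      · exact absurd hg.1.1 j.2.1)
  have hnat : P.card + S.card + z ≤ Fintype.card (N.Fwd W) + minRowRank z Cbar := by omega
  have hreal : (P.card + S.card + z : ℝ) ≤ Fintype.card (N.Fwd W) + minRowRank z Cbar := by
    exact_mod_cast hnat
  linarith
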